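/- Let $X_1,X_2,\dots$ be a strictly stationary sequence of real random variables with marginal distribution function $F$; put $M_0=-\infty$ and $M_n=\max(X_1,\dots,X_n)$. Assume that the sequence has extremal index $\theta\in(0,1]$: for every $\tau'\in(0,\infty)$ there are levels $u_n(\tau')$ with $n(1-F(u_n(\tau')))\to\tau'$ and $P(M_n\le u_n(\tau'))\to e^{-\tau'\theta}$. For $u\in\mathbb R$ let $T^*(u)=\min\{j+1\ge 1: M_j\le u,\ X_{j+1}>u\}$ be the first hitting time ($=\infty$ if $u$ is never exceeded). For $n\ge1$ let $\rho_n\in(0,1)$ and let $x_{\rho_n}$ be a quantile of $X_1$ of level $1-\rho_n$, such that for some $\tau\in(0,\infty)$ $$n(1-F(x_{\rho_n}))\to\tau,\qquad P(M_n\le x_{\rho_n})\to e^{-\tau\theta}\qquad(n\to\infty).$$ For integers $m\ge 0$, $q\ge0$ let $\alpha_{m,q}(u)=\max_{1\le k\le m-q}\sup|P(B\mid A)-P(B)|$ (and $0$ if $m-q<1$), the supremum being over $A\in\mathcal F_{1,k}(u)$ with $P(A)>0$ and $B\in\mathcal F_{k+q,m}(u)$, where $\mathcal F_{k,l}(u)$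 is the $\sigma$-field generated by the events $\{X_i>u\}$, $k\le i\le l$. Let $j_0=j_0(n)\ge 0$ be integers with $j_0(n)=o(n)$. For $n\ge1$ and $j>j_0(n)$ let $1=k_0\le k_1\le\dots\le k_5=j$ be integers and $q_1,\dots,q_5$ positive integers (all depending on $n$ and $j$) such that $k_{i-1}=o(k_i)$ and $q_i=o(k_i-k_{i-1})$ for $i=1,\dots,5$, as $n\to\infty$ and $j\to\infty$ with $j>j_0(n)$. Assume that for each $\varepsilon>0$ there are $n_\varepsilon$ and $J_\varepsilon$ such that for all $n>n_\varepsilon$ and all $j>\max(J_\varepsilon,j_0(n))$, writing $\alpha_{m,q}=\alpha_{m,q}(x_{\rho_n})$, $$\max\{\alpha_{k_4,q_1},\ \alpha_{k_3,q_2},\ \alpha_{k_3-k_2,q_3},\ \alpha_{j+1-k_2,q_4},\ \alpha_{j+1-k_1,q_5}\}<\varepsilon\quad\text{and}\quad \alpha_{j+1,k_4-k_1}/\rho_n<\varepsilon .$$ Put $$\Lambda_n=\frac{\theta^2\rho_n}{(1-(1-\rho_n)^{\theta})^3}\,(1-\rho_n)^{\theta j_0(n)}\bigl(j_0(n)(1-(1-\rho_n)^{\theta})+1\bigr)$$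 and assume that $\sup_{n\ge1}E\bigl(T^*(x_{\rho_n})^{1+\beta}\bigr)/\Lambda_n<\infty$ for some $\beta>0$. Then for each $\varepsilon>0$ there is $N$ such that for all $n>N$ the truncated mean $E T^*_{j_0}(x_{\rho_n})=\sum_{j>j_0(n)}jP\{T^*(x_{\rho_n})=j\}$ is finite and $$\left|\frac{E T^*_{j_0}(x_{\rho_n})}{\Lambda_n\rho_n}-1\right|<\varepsilon .$$ Moreover $\Lambda_n\rho_n/n\to 1/(\theta\tau)$ and $E\bigl(T^*(x_{\rho_n})\bigr)/n\to 1/(\theta\tau)$ as $n\to\infty$ (that is, $1/\theta$ if $\tau=1$), so that the first assertion refines the convergence of the mean first hitting time. -/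

import Mathlib

open MeasureTheory Filter Topology Asymptotics
open scoped ENNReal

namespace FirstHitting

noncomputable section

variable {Ω : Type*} [MeasurableSpace Ω]

/- Throughout, a sequence `X : ℕ → Ω → ℝ` stands for `X 1, X 2, …`; the value `X 0` is never used. -/

/-- Strict stationarity of `(X i)` for `i ≥ 1`: the whole sequence and its shift have the same law. -/
def IsStationary (μ : Measure Ω) (X : ℕ → Ω → ℝ) : Prop :=
  μ.map (fun ω (i : ℕ) => X (i + 2) ω) = μ.map (fun ω (i : ℕ) => X (i + 1) ω)

/-- The marginal distribution function `F`. -/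
def marginalCDF (μ : Measure Ω) (X : ℕ → Ω → ℝ) (x : ℝ) : ℝ :=
  μ.real {ω | X 1 ω ≤ x}

/-- `x` is a quantile of `X 1` of level `p`, that is `F(x-) ≤ p ≤ F(x)`. -/
def IsQuantile (μ : Measure Ω) (X : ℕ → Ω → ℝ) (p x : ℝ) : Prop :=
  μ.real {ω | X 1 ω < x} ≤ p ∧ p ≤ marginalCDF μ X x

/-- `M_n = max (X 1, …, X n)`, with `M_0 = -∞`. -/
def partialMax (X : ℕ → Ω → ℝ) (n : ℕ) (ω : Ω) : EReal :=
  (Finset.Icc 1 n).sup fun i => (X i ω : EReal)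

/-- The levels `u n` satisfy `n (1 - F(u n)) → τ` and `P(M_n ≤ u n) → exp (-τ θ)`. -/
def IsLevelSequence (μ : Measure Ω) (X : ℕ → Ω → ℝ) (θ τ : ℝ) (u : ℕ → ℝ) : Prop :=
  Tendsto (fun n : ℕ => (n : ℝ) * (1 - marginalCDF μ X (u n))) atTop (𝓝 τ) ∧
    Tendsto (fun n : ℕ => μ.real {ω | partialMax X n ω ≤ (u n : EReal)}) atTop
      (𝓝 (Real.exp (-τ * θ)))

/-- The sequence has extremal index `θ ∈ [0, 1]`. -/
def HasExtremalIndex (μ : Measure Ω) (X : ℕ → Ω → ℝ) (θ : ℝ) : Prop :=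
  0 ≤ θ ∧ θ ≤ 1 ∧ ∀ τ : ℝ, 0 < τ → ∃ u : ℕ → ℝ, IsLevelSequence μ X θ τ u

/-- The first hitting time `min {j + 1 ≥ 1 : M_j ≤ u, X_{j+1} > u}`; it is `⊤` if `u` is
never exceeded. -/
def hittingTime (X : ℕ → Ω → ℝ) (u : ℝ) (ω : Ω) : ℕ∞ :=
  sInf {t : ℕ∞ | ∃ j : ℕ, t = ((j + 1 : ℕ) : ℕ∞) ∧
    partialMax X j ω ≤ (u : EReal) ∧ u < X (j + 1) ω}

/-- The sigma-field generated by the events `{X i > u}`, `k ≤ i ≤ l`. -/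
@[reducible] def exceedanceField (X : ℕ → Ω → ℝ) (u : ℝ) (k l : ℕ) : MeasurableSpace Ω :=
  MeasurableSpace.generateFrom {s | ∃ i : ℕ, k ≤ i ∧ i ≤ l ∧ s = {ω | u < X i ω}}

/-- The mixing coefficient `α_{m,q}(u)`: the supremum of `|P(B|A) - P(B)|` over `1 ≤ k ≤ m - q`,
`A` in the field of the indices `1, …, k` with `P(A) > 0`, and `B` in the field of the indices
`k + q, …, m`. The set is bounded by `1`; the coefficient is `0` if no `k` is admissible. -/
def mixingCoeff (μ : Measure Ω) (X : ℕ → Ω → ℝ) (u : ℝ) (m q : ℕ) : ℝ :=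
  sSup {r : ℝ | ∃ k : ℕ, 1 ≤ k ∧ k + q ≤ m ∧ ∃ A B : Set Ω,
    MeasurableSet[exceedanceField X u 1 k] A ∧ MeasurableSet[exceedanceField X u (k + q) m] B ∧
      0 < μ A ∧ r = |(ProbabilityTheory.cond μ A).real B - μ.real B|}

/-- The regime `n → ∞`, `j → ∞`, `j > j₀ n` for the pair `(n, j)`. -/
def regime (j₀ : ℕ → ℕ) : Filter (ℕ × ℕ) :=
  (atTop ×ˢ atTop) ⊓ 𝓟 {p | j₀ p.1 < p.2}

/-- The partition `1 = k_0 ≤ k_1 ≤ … ≤ k_5 = j` of `[1, j]` (for every `n ≥ 1` and `j > j₀ n`)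
with `k_{i-1} = o(k_i)`, and the positive gaps `q_i = o(k_i - k_{i-1})`, `i = 1, …, 5`.
Here `k n j i` is `k_i` and, for `i : Fin 5`, `q n j i` is `q_{i+1}`. -/
structure IsPartition (j₀ : ℕ → ℕ) (k : ℕ → ℕ → Fin 6 → ℕ) (q : ℕ → ℕ → Fin 5 → ℕ) : Prop where
  first : ∀ n j, 1 ≤ n → j₀ n < j → k n j 0 = 1
  last : ∀ n j, 1 ≤ n → j₀ n < j → k n j 5 = j
  mono : ∀ n j, 1 ≤ n → j₀ n < j → Monotone (k n j)
  littleO : ∀ i : Fin 5,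
    (fun p : ℕ × ℕ => (k p.1 p.2 i.castSucc : ℝ)) =o[regime j₀]
      (fun p : ℕ × ℕ => (k p.1 p.2 i.succ : ℝ))
  gap_pos : ∀ n j, 1 ≤ n → j₀ n < j → ∀ i, 0 < q n j i
  gap_littleO : ∀ i : Fin 5,
    (fun p : ℕ × ℕ => (q p.1 p.2 i : ℝ)) =o[regime j₀]
      (fun p : ℕ × ℕ => ((k p.1 p.2 i.succ - k p.1 p.2 i.castSucc : ℕ) : ℝ))

/-- The maximum `α*_n` of five mixing coefficients, at the level `u`, for a partition `k` of
`[1, j]` with gaps `q`. -/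
def maxMixing (μ : Measure Ω) (X : ℕ → Ω → ℝ) (u : ℝ) (j : ℕ) (k : Fin 6 → ℕ) (q : Fin 5 → ℕ) :
    ℝ :=
  max (mixingCoeff μ X u (k 4) (q 0)) <|
  max (mixingCoeff μ X u (k 3) (q 1)) <|
  max (mixingCoeff μ X u (k 3 - k 2) (q 2)) <|
  max (mixingCoeff μ X u (j + 1 - k 2) (q 3))
    (mixingCoeff μ X u (j + 1 - k 1) (q 4))

/-- For each `ε > 0` there are `N` and `J` such that for all `n > N` and all `j > J`, `j > j₀ n`,
`α*_n(x n) < ε` and `α_{j+1, k_4 - k_1}(x n) / ρ n < ε`. -/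
def MixingCondition (μ : Measure Ω) (X : ℕ → Ω → ℝ) (x ρ : ℕ → ℝ) (j₀ : ℕ → ℕ)
    (k : ℕ → ℕ → Fin 6 → ℕ) (q : ℕ → ℕ → Fin 5 → ℕ) : Prop :=
  ∀ ε : ℝ, 0 < ε → ∃ N J : ℕ, ∀ n j : ℕ, N < n → J < j → j₀ n < j →
    maxMixing μ X (x n) j (k n j) (q n j) < ε ∧
      mixingCoeff μ X (x n) (j + 1) (k n j 4 - k n j 1) / ρ n < ε

/-- `E T*_{j₀}(u) = ∑_{j > j₀} j P(T*(u) = j)`, as an extended nonnegative number. -/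
def truncatedMean (μ : Measure Ω) (X : ℕ → Ω → ℝ) (u : ℝ) (j₀ : ℕ) : ℝ≥0∞ :=
  ∑' j : ℕ, if j₀ < j then (j : ℝ≥0∞) * μ {ω | hittingTime X u ω = (j : ℕ∞)} else 0

/-- `E T*(u)^s`, as an extended nonnegative number (a hitting time `⊤` contributes `∞`). -/
def hittingMoment (μ : Measure Ω) (X : ℕ → Ω → ℝ) (u s : ℝ) : ℝ≥0∞ :=
  ∫⁻ ω, ((hittingTime X u ω : ℕ∞) : ℝ≥0∞) ^ s ∂μ

/-- The normalizing quantity `Λ`. -/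
def Lam (θ ρ : ℝ) (j₀ : ℕ) : ℝ :=
  θ ^ 2 * ρ / (1 - (1 - ρ) ^ θ) ^ 3 * (1 - ρ) ^ (θ * (j₀ : ℝ)) *
    ((j₀ : ℝ) * (1 - (1 - ρ) ^ θ) + 1)

end

end FirstHitting

namespace FirstHitting

/-! Every quantity involved is asymptotic to a multiple of `n`, so all three claims follow from
first-order limits on the scale `n`. Write `G_n(m) = P(M_m ≤ x_n)`, which is also `P(T* > m)`.

Pointwise, `G_n(⌊t n⌋) → exp(-τ θ t)` for every `t > 0`: `x_n` is compared with the levels that the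
extremal index provides for `⌊t n⌋` variables (`HasExtremalIndex.tendsto_floor`).

For a domination in `t`, two blocks of length `a` separated by a gap fit into `[1, 3a]`, so mixing
gives `G_n(3a) ≤ G_n(a) (G_n(a) + ε)`. Starting from `a = S n` with `G_n(S n)` small, each tripling
gains a factor `1/9`, whence `G_n(⌊t n⌋) ≤ C / (1 + t ^ 2)`
(`exists_measureReal_noExceedance_floor_le`).

Dominated convergence in the layer-cake formula gives `E T* / n → ∫ exp(-τ θ t) dt = 1 / (θ τ)`.
Truncation costs at most `j₀ = o(n)`. Since `n ρ_n → τ`, also `Λ_n ρ_n / n → 1 / (θ τ)`, and the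
ratio tends to `1`. -/

/-- The event that none of `X a, …, X b` exceeds `u`. -/
def noExceedance {Ω : Type*} (X : ℕ → Ω → ℝ) (u : ℝ) (a b : ℕ) : Set Ω :=
  {ω | ∀ i, a ≤ i → i ≤ b → X i ω ≤ u}

/-! ### Hitting times and blocks without exceedance -/

section Events

variable {Ω : Type*} {X : ℕ → Ω → ℝ}

theorem setOf_partialMax_le (u : ℝ) (m : ℕ) :
    {ω | partialMax X m ω ≤ (u : EReal)} = noExceedance X u 1 m := by
  ext ω
  simp [partialMax, noExceedance]

theorem noExceedance_subset {u : ℝ} {a b c d : ℕ} (h₁ : a ≤ c) (h₂ : d ≤ b) :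
    noExceedance X u a b ⊆ noExceedance X u c d :=
  fun _ h i hi hi' => h i (h₁.trans hi) (hi'.trans h₂)

theorem noExceedance_mono {u v : ℝ} (h : u ≤ v) (a b : ℕ) :
    noExceedance X u a b ⊆ noExceedance X v a b :=
  fun _ h' i hi hi' => (h' i hi hi').trans h

theorem measurableSet_noExceedance_exceedanceField (u : ℝ) {a b c d : ℕ} (h₁ : c ≤ a)
    (h₂ : b ≤ d) : MeasurableSet[exceedanceField X u c d] (noExceedance X u a b) := by
  have : noExceedance X u a b = ⋂ i : ℕ, ⋂ _ : a ≤ i ∧ i ≤ b, {ω | u < X i ω}ᶜ := by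
    ext ω
    simp [noExceedance]
  rw [this]
  refine @MeasurableSet.iInter _ _ (exceedanceField X u c d) _ _ fun i =>
    @MeasurableSet.iInter _ _ (exceedanceField X u c d) _ _ fun hi => ?_
  refine @MeasurableSet.compl _ _ (exceedanceField X u c d) ?_
  exact MeasurableSpace.measurableSet_generateFrom ⟨i, h₁.trans hi.1, hi.2.trans h₂, rfl⟩

theorem natCast_lt_hittingTime_iff (u : ℝ) (ω : Ω) (m : ℕ) :
    (m : ℕ∞) < hittingTime X u ω ↔ ω ∈ noExceedance X u 1 m := by
  constructor
  · intro h
    by_contra hω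
    have hex : ∃ i, 1 ≤ i ∧ i ≤ m ∧ u < X i ω := by simpa [noExceedance] using hω
    classical
    obtain ⟨h1, hm, hu⟩ := Nat.find_spec hex
    obtain ⟨j, hj⟩ : ∃ j, Nat.find hex = j + 1 := ⟨_, (Nat.succ_pred_eq_of_pos h1).symm⟩
    have hle : hittingTime X u ω ≤ ((j + 1 : ℕ) : ℕ∞) := by
      refine sInf_le ⟨j, rfl, ?_, hj ▸ hu⟩
      have : ω ∈ noExceedance X u 1 j := fun i hi hi' => by
        by_contra hlt
        exact Nat.find_min hex (m := i) (by omega) ⟨hi, by omega, not_le.mp hlt⟩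
      rwa [← setOf_partialMax_le] at this
    have : (m : ℕ∞) < ((j + 1 : ℕ) : ℕ∞) := h.trans_le hle
    rw [Nat.cast_lt] at this
    omega
  · intro h
    have : ((m + 1 : ℕ) : ℕ∞) ≤ hittingTime X u ω := by
      refine le_sInf ?_
      rintro _ ⟨j, rfl, -, hj⟩
      rw [Nat.cast_le]
      by_contra hlt
      exact absurd (h (j + 1) (by omega) (by omega)) (not_le.mpr hj)
    exact lt_of_lt_of_le (by exact_mod_cast Nat.lt_succ_self m) this

end Events

/-! ### Stationarity and mixing -/

section Measure

variable {Ω : Type*} [MeasurableSpace Ω] {μ : Measure Ω} {X : ℕ → Ω → ℝ}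

theorem measurableSet_noExceedance (hX : ∀ i, 1 ≤ i → Measurable (X i)) (u : ℝ) {a : ℕ}
    (ha : 1 ≤ a) (b : ℕ) : MeasurableSet (noExceedance X u a b) := by
  have : noExceedance X u a b = ⋂ i : ℕ, ⋂ _ : a ≤ i ∧ i ≤ b, {ω | X i ω ≤ u} := by
    ext ω
    simp [noExceedance]
  rw [this]
  exact MeasurableSet.iInter fun i => MeasurableSet.iInter fun hi =>
    measurableSet_le (hX i (ha.trans hi.1)) measurable_const

theorem IsStationary.map_shift (hX : ∀ i, 1 ≤ i → Measurable (X i)) (h : IsStationary μ X)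
    (a : ℕ) :
    μ.map (fun ω (i : ℕ) => X (i + 1 + a) ω) = μ.map (fun ω (i : ℕ) => X (i + 1) ω) := by
  have hm : ∀ c : ℕ, Measurable fun ω (i : ℕ) => X (i + 1 + c) ω := fun c =>
    measurable_pi_lambda _ fun i => hX _ (by omega)
  induction a with
  | zero => rfl
  | succ a ih =>
    have hs : Measurable fun (f : ℕ → ℝ) (i : ℕ) => f (i + a) :=
      measurable_pi_lambda _ fun i => measurable_pi_apply _
    have := congrArg (Measure.map fun (f : ℕ → ℝ) (i : ℕ) => f (i + a)) h
    rw [Measure.map_map hs (hm 1), Measure.map_map hs (hm 0)] at this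
    rw [← ih]
    convert this using 2
    · ext ω i
      simp only [Function.comp]
      congr 1
      omega
    · ext ω i
      simp only [Function.comp]
      congr 1
      omega

theorem IsStationary.measureReal_noExceedance (hX : ∀ i, 1 ≤ i → Measurable (X i))
    (h : IsStationary μ X) (u : ℝ) (a m : ℕ) :
    μ.real (noExceedance X u (a + 1) (a + m)) = μ.real (noExceedance X u 1 m) := by
  have hm : ∀ c : ℕ, Measurable fun ω (i : ℕ) => X (i + 1 + c) ω := fun c =>
    measurable_pi_lambda _ fun i => hX _ (by omega)
  set S : Set (ℕ → ℝ) := {f | ∀ i, i < m → f i ≤ u} with hS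
  have hSm : MeasurableSet S := by
    have : S = ⋂ i : ℕ, ⋂ _ : i < m, {f | f i ≤ u} := by ext f; simp [hS]
    rw [this]
    exact MeasurableSet.iInter fun i => MeasurableSet.iInter fun hi =>
      measurableSet_le (measurable_pi_apply i) measurable_const
  have key : ∀ c : ℕ, μ.real (noExceedance X u (c + 1) (c + m)) =
      (μ.map fun ω (i : ℕ) => X (i + 1 + c) ω).real S := fun c => by
    rw [map_measureReal_apply (hm c) hSm]
    congr 1
    ext ω
    simp only [noExceedance, hS, Set.mem_ofPred_eq, Set.mem_preimage]
    constructor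
    · intro h i hi
      exact h _ (by omega) (by omega)
    · intro h i hi hi'
      have := h (i - (c + 1)) (by omega)
      rwa [show i - (c + 1) + 1 + c = i by omega] at this
  have h0 := key 0
  rw [zero_add, zero_add] at h0
  rw [key a, h.map_shift hX a, h0]

theorem le_mixingCoeff [IsProbabilityMeasure μ] (u : ℝ) {m q k : ℕ} (hk : 1 ≤ k)
    (hkq : k + q ≤ m) {A B : Set Ω} (hA : MeasurableSet[exceedanceField X u 1 k] A)
    (hB : MeasurableSet[exceedanceField X u (k + q) m] B) (hA0 : 0 < μ A) :
    |(ProbabilityTheory.cond μ A).real B - μ.real B| ≤ mixingCoeff μ X u m q := by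
  refine le_csSup ⟨1, ?_⟩ ⟨k, hk, hkq, A, B, hA, hB, hA0, rfl⟩
  rintro r ⟨_, -, -, A, B, -, -, h0, rfl⟩
  have := ProbabilityTheory.cond_isProbabilityMeasure h0.ne'
  rw [abs_le]
  have h1 := measureReal_nonneg (μ := ProbabilityTheory.cond μ A) (s := B)
  have h2 := measureReal_nonneg (μ := μ) (s := B)
  have h3 : (ProbabilityTheory.cond μ A).real B ≤ 1 := measureReal_le_one
  have h4 : μ.real B ≤ 1 := measureReal_le_one
  constructor <;> linarith

/-- Two blocks of length `a` separated by a gap of length `q` are almost independent. -/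
theorem measureReal_noExceedance_le_mul [IsProbabilityMeasure μ]
    (hX : ∀ i, 1 ≤ i → Measurable (X i)) (h : IsStationary μ X) (u : ℝ) {a b m q : ℕ}
    (ha : 1 ≤ a) (hq : 1 ≤ q) (hm : 2 * a + q ≤ m + 1) (hb : m ≤ b) :
    μ.real (noExceedance X u 1 b) ≤ μ.real (noExceedance X u 1 a) *
      (μ.real (noExceedance X u 1 a) + mixingCoeff μ X u m q) := by
  set A := noExceedance X u 1 a
  set B := noExceedance X u (a + q) m
  have hAm : MeasurableSet A := measurableSet_noExceedance hX u le_rfl a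
  have hle : μ.real (noExceedance X u 1 b) ≤ μ.real (A ∩ B) :=
    measureReal_mono (Set.subset_inter (noExceedance_subset le_rfl (by omega))
      (noExceedance_subset (by omega) hb))
  -- As `m ≥ 2a + q - 1`, the block `[a + q, m]` contains a translate of `[1, a]`.
  have hBA : μ.real B ≤ μ.real A := by
    rw [← h.measureReal_noExceedance hX u (a + q - 1) a]
    exact measureReal_mono (noExceedance_subset (by omega) (by omega))
  -- The mixing coefficient only controls conditioning events of positive probability; a null `A` is
  -- treated apart.
  rcases eq_or_lt_of_le (zero_le (a := μ A)) with h0 | h0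
  · have hA0 : μ.real A = 0 := by simp [Measure.real, ← h0]
    have : μ.real (A ∩ B) ≤ μ.real A := measureReal_mono Set.inter_subset_left
    rw [hA0, zero_mul]
    linarith
  · have hα := (abs_le.mp (le_mixingCoeff (μ := μ) (X := X) u (q := q) (m := m) ha (by omega)
      (measurableSet_noExceedance_exceedanceField u le_rfl le_rfl)
      (measurableSet_noExceedance_exceedanceField u le_rfl le_rfl) h0)).2
    have hc : μ.real (A ∩ B) = μ.real A * (ProbabilityTheory.cond μ A).real B := by
      have hne : μ.real A ≠ 0 := (ENNReal.toReal_pos h0.ne' (measure_ne_top μ A)).ne'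
      rw [measureReal_def (ProbabilityTheory.cond μ A), ProbabilityTheory.cond_apply hAm,
        ENNReal.toReal_mul, ENNReal.toReal_inv]
      exact (mul_inv_cancel_left₀ hne _).symm
    refine hle.trans (hc.le.trans (mul_le_mul_of_nonneg_left ?_ measureReal_nonneg))
    change (ProbabilityTheory.cond μ A).real B - μ.real B ≤ _ at hα
    linarith

end Measure

/-! ### Comparison of levels through the extremal index -/

section Levels

variable {Ω : Type*} [MeasurableSpace Ω] {μ : Measure Ω} [IsProbabilityMeasure μ]
  {X : ℕ → Ω → ℝ}

theorem marginalCDF_mono : Monotone (marginalCDF μ X) := fun _ _ h =>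
  measureReal_mono fun _ h' => le_trans h' h

/-- At levels `x n` with `n (1 - F(x n)) → τ`, the maximum of `⌊s n⌋` variables stays below
`x n` with asymptotic probability `exp (-τ θ s)`. -/
theorem HasExtremalIndex.tendsto_floor {θ τ : ℝ} (hindex : HasExtremalIndex μ X θ) (hτ : 0 < τ)
    {x : ℕ → ℝ} (hx : Tendsto (fun n : ℕ => (n : ℝ) * (1 - marginalCDF μ X (x n))) atTop (𝓝 τ))
    {s : ℝ} (hs : 0 < s) :
    Tendsto (fun n : ℕ => μ.real (noExceedance X (x n) 1 ⌊s * n⌋₊)) atTop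
      (𝓝 (Real.exp (-(τ * θ) * s))) := by
  have hfl : Tendsto (fun n : ℕ => ⌊s * n⌋₊) atTop atTop :=
    tendsto_nat_floor_atTop.comp (tendsto_natCast_atTop_atTop.const_mul_atTop hs)
  have hscale : Tendsto (fun n : ℕ => (⌊s * n⌋₊ : ℝ) * (1 - marginalCDF μ X (x n))) atTop
      (𝓝 (s * τ)) := by
    have h1 : Tendsto (fun n : ℕ => (⌊s * n⌋₊ : ℝ) / n) atTop (𝓝 s) :=
      (tendsto_nat_floor_mul_div_atTop hs.le).comp tendsto_natCast_atTop_atTop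
    refine (h1.mul hx).congr' ?_
    filter_upwards [eventually_ge_atTop 1] with n hn
    have : (n : ℝ) ≠ 0 := by positivity
    field_simp
  have hcont : Tendsto (fun t : ℝ => Real.exp (-t * θ)) (𝓝 (s * τ))
      (𝓝 (Real.exp (-(τ * θ) * s))) := by
    have : Continuous fun t : ℝ => Real.exp (-t * θ) := by fun_prop
    convert this.tendsto (s * τ) using 3
    ring
  have hsτ : 0 < s * τ := mul_pos hs hτ
  have hpos : ∀ᶠ n : ℕ in atTop, (0 : ℝ) < (⌊s * n⌋₊ : ℝ) := by
    filter_upwards [hfl.eventually_ge_atTop 1] with n hn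
    exact_mod_cast hn
  refine tendsto_order.2 ⟨fun a ha => ?_, fun a ha => ?_⟩
  -- Take `t` slightly above `s τ`. The levels `v` for `t`, at index `⌊s n⌋`, have a larger
  -- exceedance probability than `x n`, so they lie below it and give a lower bound. The upper bound
  -- uses `t` slightly below `s τ`.
  · obtain ⟨t, hta, ht⟩ := (((hcont.eventually (lt_mem_nhds ha)).filter_mono
      nhdsWithin_le_nhds).and (self_mem_nhdsWithin (s := Set.Ioi (s * τ)))).exists
    obtain ⟨v, hv, hv'⟩ := hindex.2.2 t (hsτ.trans ht)
    filter_upwards [(hv'.comp hfl).eventually (lt_mem_nhds hta),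
      hscale.eventually_lt (hv.comp hfl) ht, hpos] with n h1 h2 h3
    simp only [Function.comp, setOf_partialMax_le] at h1 h2
    refine h1.trans_le (measureReal_mono (noExceedance_mono ?_ _ _))
    by_contra! hlt
    have := marginalCDF_mono (μ := μ) (X := X) hlt.le
    have := lt_of_mul_lt_mul_left h2 h3.le
    linarith
  · obtain ⟨t, ⟨hta, ht⟩, ht0⟩ := ((((hcont.eventually (gt_mem_nhds ha)).filter_mono
      nhdsWithin_le_nhds).and (self_mem_nhdsWithin (s := Set.Iio (s * τ)))).and
      ((lt_mem_nhds hsτ).filter_mono nhdsWithin_le_nhds)).exists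
    obtain ⟨v, hv, hv'⟩ := hindex.2.2 t ht0
    filter_upwards [(hv'.comp hfl).eventually (gt_mem_nhds hta),
      (hv.comp hfl).eventually_lt hscale ht, hpos] with n h1 h2 h3
    simp only [Function.comp, setOf_partialMax_le] at h1 h2
    refine lt_of_le_of_lt (measureReal_mono (noExceedance_mono ?_ _ _)) h1
    by_contra! hlt
    have := marginalCDF_mono (μ := μ) (X := X) hlt.le
    have := lt_of_mul_lt_mul_left h2 h3.le
    linarith

/-- An extremal index forces the jumps of `F` to be negligible in the tail, so that the level of a
quantile has the order of the exceedance probability. -/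
theorem HasExtremalIndex.tendsto_quantile {θ τ : ℝ} (hindex : HasExtremalIndex μ X θ)
    (hτ : 0 < τ) {x ρ : ℕ → ℝ}
    (hx : Tendsto (fun n : ℕ => (n : ℝ) * (1 - marginalCDF μ X (x n))) atTop (𝓝 τ))
    (hquant : ∀ n, 1 ≤ n → IsQuantile μ X (1 - ρ n) (x n)) :
    Tendsto (fun n : ℕ => (n : ℝ) * ρ n) atTop (𝓝 τ) := by
  refine tendsto_order.2 ⟨fun a ha => ?_, fun a ha => ?_⟩
  · filter_upwards [hx.eventually (lt_mem_nhds ha), eventually_ge_atTop 1] with n h1 hn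
    refine h1.trans_le (mul_le_mul_of_nonneg_left ?_ n.cast_nonneg)
    linarith [(hquant n hn).2]
  -- A level `v n` for some `t > τ` lies strictly below `x n`, so `F(v n) ≤ F(x n -) ≤ 1 - ρ n`: a
  -- jump of `F` at `x n` cannot make `ρ n` too large.
  · obtain ⟨t, ht, hta⟩ := exists_between ha
    obtain ⟨v, hv, -⟩ := hindex.2.2 t (hτ.trans ht)
    filter_upwards [hv.eventually (gt_mem_nhds hta), hx.eventually_lt hv ht,
      eventually_ge_atTop 1] with n h1 h2 hn
    refine lt_of_le_of_lt (mul_le_mul_of_nonneg_left ?_ n.cast_nonneg) h1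
    have hlt : v n < x n := by
      by_contra! hle
      have := marginalCDF_mono (μ := μ) (X := X) hle
      have := lt_of_mul_lt_mul_left h2 n.cast_nonneg
      linarith
    have : marginalCDF μ X (v n) ≤ μ.real {ω | X 1 ω < x n} :=
      measureReal_mono fun ω hω => lt_of_le_of_lt hω hlt
    linarith [(hquant n hn).1]

end Levels

/-! ### Asymptotics of the normalization -/

section Lam

theorem tendsto_one_sub_one_sub_rpow_div (θ : ℝ) :
    Tendsto (fun r : ℝ => (1 - (1 - r) ^ θ) / r) (𝓝[≠] 0) (𝓝 θ) := by
  have h : HasDerivAt (fun r : ℝ => 1 - (1 - r) ^ θ) θ 0 := by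
    have h1 : HasDerivAt (fun r : ℝ => 1 - r) (-1) 0 := by
      simpa using (hasDerivAt_id (0 : ℝ)).const_sub 1
    have h2 := (h1.rpow_const (p := θ) (Or.inl (by norm_num))).const_sub 1
    simpa using h2
  refine (hasDerivAt_iff_tendsto_slope.1 h).congr fun r => ?_
  simp [slope_def_field]

theorem tendsto_one_sub_rpow_mul {ι : Type*} {l : Filter ι} {r m : ι → ℝ} (θ : ℝ)
    (hr : Tendsto r l (𝓝[≠] 0)) (hm : Tendsto (fun i => m i * r i) l (𝓝 0)) :
    Tendsto (fun i => (1 - r i) ^ (θ * m i)) l (𝓝 1) := by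
  have hd : HasDerivAt (fun r : ℝ => Real.log (1 - r)) (-1) 0 := by
    have h1 : HasDerivAt (fun r : ℝ => 1 - r) (-1) 0 := by
      simpa using (hasDerivAt_id (0 : ℝ)).const_sub 1
    simpa using h1.log (by norm_num)
  have hlog : Tendsto (fun i => Real.log (1 - r i) / r i) l (𝓝 (-1)) :=
    ((hasDerivAt_iff_tendsto_slope.1 hd).comp hr).congr fun i => by simp [slope_def_field]
  have hr0 : Tendsto r l (𝓝 0) := hr.mono_right nhdsWithin_le_nhds
  have he : Tendsto (fun i => Real.exp (Real.log (1 - r i) / r i * (θ * (m i * r i)))) l (𝓝 1) := by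
    simpa [Function.comp_def] using (Real.continuous_exp.tendsto _).comp (hlog.mul (hm.const_mul θ))
  refine he.congr' ?_
  filter_upwards [hr0.eventually (gt_mem_nhds zero_lt_one),
    hr.eventually self_mem_nhdsWithin] with i h1 h2
  have h2 : r i ≠ 0 := h2
  rw [Real.rpow_def_of_pos (by linarith)]
  congr 1
  field_simp

/-- With `w = (1 - (1 - ρ)^θ) / ρ → θ`, the quotient is `θ² w⁻³ (n ρ)⁻¹ (1 - ρ)^(θ j₀) (j₀ ρ w +
1)`, and `j₀ ρ = (j₀ / n) (n ρ) → 0` removes the influence of `j₀`. -/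
theorem tendsto_Lam_mul_div {θ τ : ℝ} (hθ : 0 < θ) (hτ : 0 < τ) {ρ : ℕ → ℝ}
    (hρ : ∀ n, 1 ≤ n → 0 < ρ n) (hρτ : Tendsto (fun n : ℕ => (n : ℝ) * ρ n) atTop (𝓝 τ))
    {j₀ : ℕ → ℕ} (hj₀ : (fun n => (j₀ n : ℝ)) =o[atTop] (fun n : ℕ => (n : ℝ))) :
    Tendsto (fun n : ℕ => Lam θ (ρ n) (j₀ n) * ρ n / (n : ℝ)) atTop (𝓝 (1 / (θ * τ))) := by
  have hne : ∀ᶠ n : ℕ in atTop, ρ n ≠ 0 := by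
    filter_upwards [eventually_ge_atTop 1] with n hn using (hρ n hn).ne'
  have hρ0 : Tendsto ρ atTop (𝓝[≠] 0) := by
    refine tendsto_nhdsWithin_iff.2 ⟨?_, hne⟩
    have := hρτ.mul (tendsto_inv_atTop_nhds_zero_nat (𝕜 := ℝ))
    rw [mul_zero] at this
    refine this.congr' ?_
    filter_upwards [eventually_ge_atTop 1] with n hn
    have : (n : ℝ) ≠ 0 := by positivity
    field_simp
  have hjρ : Tendsto (fun n => (j₀ n : ℝ) * ρ n) atTop (𝓝 0) := by
    have := hj₀.tendsto_div_nhds_zero.mul hρτ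
    rw [zero_mul] at this
    refine this.congr' ?_
    filter_upwards [eventually_ge_atTop 1] with n hn
    have : (n : ℝ) ≠ 0 := by positivity
    field_simp
  have hw := (tendsto_one_sub_one_sub_rpow_div θ).comp hρ0
  have hlim : Tendsto (fun n : ℕ => θ ^ 2 * (((1 - (1 - ρ n) ^ θ) / ρ n) ^ 3)⁻¹ *
      ((n : ℝ) * ρ n)⁻¹ * (1 - ρ n) ^ (θ * (j₀ n : ℝ)) *
      ((j₀ n : ℝ) * ρ n * ((1 - (1 - ρ n) ^ θ) / ρ n) + 1)) atTop
      (𝓝 (θ ^ 2 * (θ ^ 3)⁻¹ * τ⁻¹ * 1 * (0 * θ + 1))) :=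
    ((((hw.pow 3).inv₀ (by positivity)).const_mul (θ ^ 2)).mul (hρτ.inv₀ hτ.ne')).mul
      (tendsto_one_sub_rpow_mul θ hρ0 hjρ) |>.mul ((hjρ.mul hw).add_const 1)
  have hc : θ ^ 2 * (θ ^ 3)⁻¹ * τ⁻¹ * 1 * (0 * θ + 1) = 1 / (θ * τ) := by
    field_simp
    ring
  rw [hc] at hlim
  refine hlim.congr' ?_
  filter_upwards [hne, eventually_ge_atTop 1, hw.eventually (lt_mem_nhds hθ)] with n h1 hn h2
  have h3 : (n : ℝ) ≠ 0 := by positivity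
  have h4 : 1 - (1 - ρ n) ^ θ ≠ 0 := by
    rintro h
    simp [Function.comp, h] at h2
  unfold Lam
  generalize 1 - (1 - ρ n) ^ θ = w at *
  generalize (1 - ρ n) ^ (θ * (j₀ n : ℝ)) = z at *
  field_simp

end Lam

/-! ### Quadratic decay of the tails by tripling -/

section Decay

variable {Ω : Type*} [MeasurableSpace Ω] {μ : Measure Ω} [IsProbabilityMeasure μ]
  {X : ℕ → Ω → ℝ}

theorem eventually_regime {j₀ : ℕ → ℕ} {p : ℕ × ℕ → Prop} :
    (∀ᶠ z in regime j₀, p z) ↔ ∃ N : ℕ, ∀ n j, N ≤ n → N ≤ j → j₀ n < j → p (n, j) := by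
  rw [regime, eventually_inf_principal, prod_atTop_atTop_eq, eventually_atTop]
  constructor
  · rintro ⟨⟨a, b⟩, h⟩
    exact ⟨max a b, fun n j hn hj => h (n, j) ⟨(le_max_left a b).trans hn,
      (le_max_right a b).trans hj⟩⟩
  · rintro ⟨N, h⟩
    exact ⟨(N, N), fun z hz => h z.1 z.2 hz.1 hz.2⟩

theorem IsPartition.eventually_small {j₀ : ℕ → ℕ} {k : ℕ → ℕ → Fin 6 → ℕ}
    {q : ℕ → ℕ → Fin 5 → ℕ} (hpart : IsPartition j₀ k q) :
    ∃ N : ℕ, ∀ n j, N ≤ n → N ≤ j → j₀ n < j → 10 * k n j 1 ≤ j ∧ 10 * q n j 4 ≤ j := by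
  have h1 := (hpart.littleO 4).bound (c := 1 / 10) (by norm_num)
  have h2 := (hpart.gap_littleO 4).bound (c := 1 / 10) (by norm_num)
  obtain ⟨N, hN⟩ := eventually_regime.1 (h1.and h2)
  refine ⟨max N 1, fun n j hn hj hj₀ => ?_⟩
  obtain ⟨h3, h4⟩ := hN n j (le_of_max_le_left hn) (le_of_max_le_left hj) hj₀
  have hn1 : 1 ≤ n := le_of_max_le_right hn
  simp only [Real.norm_natCast] at h3 h4
  have hlast : k n j (Fin.succ 4) = j := hpart.last n j hn1 hj₀
  have hk : k n j 1 ≤ k n j (Fin.castSucc 4) := hpart.mono n j hn1 hj₀ (by decide)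
  rw [hlast] at h3 h4
  have h5 : 10 * k n j (Fin.castSucc 4) ≤ j := by
    have : (10 : ℝ) * k n j (Fin.castSucc 4) ≤ j := by linarith
    exact_mod_cast this
  have h6 : 10 * q n j 4 ≤ j - k n j (Fin.castSucc 4) := by
    have : (10 : ℝ) * q n j 4 ≤ ((j - k n j (Fin.castSucc 4) : ℕ) : ℝ) := by linarith
    exact_mod_cast this
  omega

/-- Taken at `j = 3a`, the coefficient `α_{j+1-k₁, q₅}` suffices: `k₁` and `q₅` are at most `j /
10`, which leaves room for two blocks of length `a` and the gap. -/
theorem eventually_measureReal_noExceedance_three_mul_le (hX : ∀ i, 1 ≤ i → Measurable (X i))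
    (hstat : IsStationary μ X) {x ρ : ℕ → ℝ} {j₀ : ℕ → ℕ} {k : ℕ → ℕ → Fin 6 → ℕ}
    {q : ℕ → ℕ → Fin 5 → ℕ} (hpart : IsPartition j₀ k q) (hmix : MixingCondition μ X x ρ j₀ k q)
    {ε : ℝ} (hε : 0 < ε) :
    ∃ N : ℕ, ∀ n a, N ≤ n → N ≤ a → j₀ n < 3 * a →
      μ.real (noExceedance X (x n) 1 (3 * a)) ≤ μ.real (noExceedance X (x n) 1 a) *
        (μ.real (noExceedance X (x n) 1 a) + ε) := by
  obtain ⟨N₁, h₁⟩ := hpart.eventually_small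
  obtain ⟨N₂, J, h₂⟩ := hmix ε hε
  refine ⟨N₁ + N₂ + J + 1, fun n a hn ha hj => ?_⟩
  obtain ⟨hk, hq⟩ := h₁ n (3 * a) (by omega) (by omega) hj
  have hk1 : 1 ≤ k n (3 * a) 1 := by
    rw [← hpart.first n (3 * a) (by omega) hj]
    exact hpart.mono n (3 * a) (by omega) hj (by decide)
  have hq1 := hpart.gap_pos n (3 * a) (by omega) hj 4
  refine (measureReal_noExceedance_le_mul hX hstat (x n) (a := a) (b := 3 * a)
    (m := 3 * a + 1 - k n (3 * a) 1) (q := q n (3 * a) 4) (by omega) hq1 (by omega)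
    (by omega)).trans (mul_le_mul_of_nonneg_left ?_ measureReal_nonneg)
  have h := (h₂ n (3 * a) (by omega) (by omega) hj).1
  simp only [maxMixing, max_lt_iff] at h
  linarith [h.2.2.2.2]

/-- The tails of the hitting times on the scale `n` are integrable, uniformly in `n`. -/
theorem exists_measureReal_noExceedance_floor_le (hX : ∀ i, 1 ≤ i → Measurable (X i))
    (hstat : IsStationary μ X) {θ τ : ℝ} (hθ : 0 < θ) (hindex : HasExtremalIndex μ X θ)
    (hτ : 0 < τ) {x ρ : ℕ → ℝ}
    (hx : Tendsto (fun n : ℕ => (n : ℝ) * (1 - marginalCDF μ X (x n))) atTop (𝓝 τ))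
    {j₀ : ℕ → ℕ} (hj₀ : (fun n => (j₀ n : ℝ)) =o[atTop] (fun n : ℕ => (n : ℝ)))
    {k : ℕ → ℕ → Fin 6 → ℕ} {q : ℕ → ℕ → Fin 5 → ℕ} (hpart : IsPartition j₀ k q)
    (hmix : MixingCondition μ X x ρ j₀ k q) :
    ∃ C : ℝ, ∀ᶠ n : ℕ in atTop, ∀ t : ℝ, 0 < t →
      μ.real (noExceedance X (x n) 1 ⌊t * n⌋₊) ≤ C * (1 + t ^ 2)⁻¹ := by
  have hexp : Tendsto (fun S : ℕ => Real.exp (-(τ * θ) * S)) atTop (𝓝 0) :=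
    Real.tendsto_exp_atBot.comp
      (tendsto_natCast_atTop_atTop.const_mul_atTop_of_neg (neg_lt_zero.2 (mul_pos hτ hθ)))
  -- With `G ≤ 1/18` and `ε = 1/18`, one tripling multiplies the bound by at most `1/18 + 1/18 = 1/9
  -- = 3⁻²`, which is the decay `t⁻²`.
  obtain ⟨S, hS, hS1⟩ := ((hexp.eventually (gt_mem_nhds (show (0 : ℝ) < 1 / 18 by norm_num))).and
    (eventually_ge_atTop 1)).exists
  have hS0 : (1 : ℝ) ≤ S := by exact_mod_cast hS1
  obtain ⟨N, hN⟩ := eventually_measureReal_noExceedance_three_mul_le hX hstat hpart hmix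
    (show (0 : ℝ) < 1 / 18 by norm_num)
  refine ⟨18 * (S : ℝ) ^ 2, ?_⟩
  filter_upwards [(hindex.tendsto_floor hτ hx (s := S) (by linarith)).eventually (gt_mem_nhds hS),
    hj₀.bound (c := 1) one_pos, eventually_ge_atTop (N + 1)] with n h1 h2 hn t ht
  have hj : j₀ n ≤ n := by
    simp only [Real.norm_natCast, one_mul] at h2
    exact_mod_cast h2
  have hfl : ⌊(S : ℝ) * n⌋₊ = S * n := by
    rw [← Nat.cast_mul, Nat.floor_natCast]
  rw [hfl] at h1
  have hdecay : ∀ r : ℕ, μ.real (noExceedance X (x n) 1 (3 ^ r * (S * n))) ≤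
      1 / 18 * ((9 : ℝ) ^ r)⁻¹ := by
    intro r
    induction r with
    | zero => simpa using h1.le
    | succ r ih =>
      have hge : n ≤ 3 ^ r * (S * n) := by
        calc n = 1 * (1 * n) := by ring
          _ ≤ 3 ^ r * (S * n) := by gcongr; exact Nat.one_le_pow _ _ (by norm_num)
      have := hN n (3 ^ r * (S * n)) (by omega) (by omega) (by omega)
      rw [pow_succ', mul_assoc]
      refine this.trans ?_
      have h9 : ((9 : ℝ) ^ r)⁻¹ ≤ 1 := inv_le_one_of_one_le₀ (one_le_pow₀ (by norm_num))
      calc _ ≤ 1 / 18 * ((9 : ℝ) ^ r)⁻¹ * (1 / 18 + 1 / 18) := by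
            gcongr
            linarith
        _ = 1 / 18 * ((9 : ℝ) ^ (r + 1))⁻¹ := by rw [pow_succ, mul_inv]; ring
  rw [← div_eq_mul_inv, le_div_iff₀ (by positivity)]
  rcases lt_or_ge t S with hlt | hge
  · have : μ.real (noExceedance X (x n) 1 ⌊t * n⌋₊) ≤ 1 := measureReal_le_one
    calc _ ≤ 1 * (1 + t ^ 2) := by gcongr
      _ ≤ 18 * (S : ℝ) ^ 2 := by nlinarith
  -- Locate `t / S` in `[3^r, 3^(r+1))`.
  · obtain ⟨r, hr, hr'⟩ := exists_nat_pow_near (x := t / S) (y := 3)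
      ((one_le_div (by linarith)).2 hge) (by norm_num)
    rw [le_div_iff₀ (by linarith)] at hr
    rw [div_lt_iff₀ (by linarith)] at hr'
    have hle : 3 ^ r * (S * n) ≤ ⌊t * n⌋₊ := by
      rw [Nat.le_floor_iff (by positivity)]
      push_cast
      rw [← mul_assoc]
      gcongr
    have hG := (measureReal_mono (μ := μ)
      (noExceedance_subset (X := X) (u := x n) (le_refl 1) hle)).trans (hdecay r)
    have ht2 : 1 + t ^ 2 ≤ 18 * (S : ℝ) ^ 2 * 9 ^ r := by
      have h3 : t ^ 2 ≤ (3 ^ (r + 1) * S) ^ 2 := by gcongr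
      have h4 : ((3 : ℝ) ^ (r + 1) * S) ^ 2 = 9 * (S : ℝ) ^ 2 * 9 ^ r := by
        rw [show (9 : ℝ) ^ r = (3 ^ r) ^ 2 by rw [← pow_mul, mul_comm, pow_mul]; norm_num]
        ring
      nlinarith
    calc _ ≤ 1 / 18 * ((9 : ℝ) ^ r)⁻¹ * (18 * (S : ℝ) ^ 2 * 9 ^ r) := by gcongr
      _ = (S : ℝ) ^ 2 := by field_simp
      _ ≤ _ := by nlinarith

end Decay

/-! ### Mean hitting times -/

section Moments

variable {Ω : Type*} [MeasurableSpace Ω] {μ : Measure Ω} {X : ℕ → Ω → ℝ}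

theorem measurable_hittingTime (hX : ∀ i, 1 ≤ i → Measurable (X i)) (u : ℝ) :
    Measurable (hittingTime X u) := by
  have hgt : ∀ m : ℕ, MeasurableSet {ω | (m : ℕ∞) < hittingTime X u ω} := fun m => by
    simp only [natCast_lt_hittingTime_iff]
    exact measurableSet_noExceedance hX u le_rfl m
  refine measurable_to_countable' fun y => ?_
  induction y with
  | top =>
    have : hittingTime X u ⁻¹' {⊤} = ⋂ m : ℕ, {ω | (m : ℕ∞) < hittingTime X u ω} := by
      ext ω
      simp [ENat.eq_top_iff_forall_gt]
    rw [this]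
    exact MeasurableSet.iInter hgt
  | coe j =>
    have : hittingTime X u ⁻¹' {(j : ℕ∞)} = {ω | (j : ℕ∞) < hittingTime X u ω}ᶜ ∩
        ⋂ m : ℕ, ⋂ _ : m < j, {ω | (m : ℕ∞) < hittingTime X u ω} := by
      ext ω
      simp only [Set.mem_preimage, Set.mem_singleton_iff, Set.mem_inter_iff, Set.mem_compl_iff,
        Set.mem_ofPred_eq, Set.mem_iInter, not_lt]
      induction h : hittingTime X u ω with
      | top => simp
      | coe m =>
        simp only [Nat.cast_inj, Nat.cast_le, Nat.cast_lt]
        refine ⟨fun h => by subst h; simp, fun h => ?_⟩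
        by_contra hne
        exact absurd (h.2 m (by omega)) (lt_irrefl _)
    rw [this]
    exact (hgt j).compl.inter (MeasurableSet.iInter fun m => MeasurableSet.iInter fun _ => hgt m)

theorem hittingMoment_one (u : ℝ) :
    hittingMoment μ X u 1 = ∫⁻ ω, ((hittingTime X u ω : ℕ∞) : ℝ≥0∞) ∂μ := by
  simp [hittingMoment]

/-- This is the layer-cake formula for `T* / n`; as `T*` is an integer, `t < T* / n` means `⌊t n⌋ <
T*`. Finiteness is needed because `toNat` sends `⊤` to `0`. -/
theorem hittingMoment_one_div_eq_lintegral (hX : ∀ i, 1 ≤ i → Measurable (X i)) (u : ℝ)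
    (hfin : ∀ᵐ ω ∂μ, hittingTime X u ω ≠ ⊤) {n : ℕ} (hn : 1 ≤ n) :
    hittingMoment μ X u 1 / (n : ℝ≥0∞) =
      ∫⁻ t in Set.Ioi (0 : ℝ), μ (noExceedance X u 1 ⌊t * n⌋₊) := by
  have hn0 : (0 : ℝ) < n := by exact_mod_cast hn
  have hmeas : Measurable fun ω => ((hittingTime X u ω).toNat : ℝ) / n :=
    ((measurable_from_top (f := fun m : ℕ∞ => (m.toNat : ℝ) / n)).comp
      (measurable_hittingTime hX u))
  have hlayer := lintegral_eq_lintegral_meas_lt (f := fun ω => ((hittingTime X u ω).toNat : ℝ) / n)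
    μ (Eventually.of_forall fun ω => by positivity) hmeas.aemeasurable
  rw [hittingMoment_one, div_eq_mul_inv, ← lintegral_mul_const]
  rotate_left
  · exact (measurable_from_top (f := fun m : ℕ∞ => (m : ℝ≥0∞))).comp (measurable_hittingTime hX u)
  rw [lintegral_congr_ae (g := fun ω => ENNReal.ofReal (((hittingTime X u ω).toNat : ℝ) / n)),
    hlayer]
  · refine setLIntegral_congr_fun measurableSet_Ioi fun t ht => ?_
    have ht : 0 < t := ht
    refine measure_congr ?_
    filter_upwards [hfin] with ω hω
    refine propext ?_
    change t < ((hittingTime X u ω).toNat : ℝ) / n ↔ ω ∈ noExceedance X u 1 ⌊t * n⌋₊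
    rw [← natCast_lt_hittingTime_iff, lt_div_iff₀ hn0]
    obtain ⟨m, hm⟩ := ENat.ne_top_iff_exists.1 hω
    rw [← hm, ENat.toNat_natCast, Nat.cast_lt, Nat.floor_lt (by positivity)]
  · filter_upwards [hfin] with ω hω
    obtain ⟨m, hm⟩ := ENat.ne_top_iff_exists.1 hω
    rw [← hm, ENat.toNat_natCast, ENNReal.ofReal_div_of_pos hn0, ENNReal.ofReal_natCast,
      ENNReal.ofReal_natCast, div_eq_mul_inv]
    simp

theorem truncatedMean_eq_lintegral (hX : ∀ i, 1 ≤ i → Measurable (X i)) (u : ℝ) (j₀ : ℕ) :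
    truncatedMean μ X u j₀ = ∫⁻ ω, (∑' j : ℕ, if j₀ < j ∧ hittingTime X u ω = j
      then (j : ℝ≥0∞) else 0) ∂μ := by
  rw [lintegral_tsum]
  · refine tsum_congr fun j => ?_
    split_ifs with hj
    · simp only [hj, true_and]
      have hm : MeasurableSet {ω | hittingTime X u ω = j} :=
        measurable_hittingTime hX u (measurableSet_singleton (j : ℕ∞))
      rw [← lintegral_indicator_const hm]
      refine lintegral_congr fun ω => ?_
      simp [Set.indicator_apply]
    · simp [hj]
  · intro j
    refine Measurable.aemeasurable ?_
    exact (measurable_from_top (f := fun m : ℕ∞ => if j₀ < j ∧ m = j then (j : ℝ≥0∞) else 0)).comp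
      (measurable_hittingTime hX u)

theorem tsum_ite_lt_and_eq (j₀ m : ℕ) :
    (∑' j : ℕ, if j₀ < j ∧ (m : ℕ∞) = j then (j : ℝ≥0∞) else 0) =
      if j₀ < m then (m : ℝ≥0∞) else 0 := by
  rw [tsum_eq_single m]
  · simp
  · intro j hj
    rw [if_neg]
    rintro ⟨-, h⟩
    exact hj (by exact_mod_cast h.symm)

theorem truncatedMean_le_hittingMoment (hX : ∀ i, 1 ≤ i → Measurable (X i)) (u : ℝ) (j₀ : ℕ) :
    truncatedMean μ X u j₀ ≤ hittingMoment μ X u 1 := by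
  rw [truncatedMean_eq_lintegral hX, hittingMoment_one]
  refine lintegral_mono fun ω => ?_
  induction h : hittingTime X u ω with
  | top => simp
  | coe m =>
    simp only [tsum_ite_lt_and_eq]
    split_ifs <;> simp

/-- The omitted part of the mean comes from `T* ≤ j₀`, where `T*` contributes at most `j₀`. -/
theorem hittingMoment_le_truncatedMean_add [IsProbabilityMeasure μ]
    (hX : ∀ i, 1 ≤ i → Measurable (X i)) (u : ℝ) (hfin : ∀ᵐ ω ∂μ, hittingTime X u ω ≠ ⊤)
    (j₀ : ℕ) : hittingMoment μ X u 1 ≤ truncatedMean μ X u j₀ + j₀ := by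
  have h1 : (j₀ : ℝ≥0∞) = ∫⁻ _, (j₀ : ℝ≥0∞) ∂μ := by simp
  rw [truncatedMean_eq_lintegral hX, hittingMoment_one, h1, ← lintegral_add_right _ (by fun_prop)]
  refine lintegral_mono_ae ?_
  filter_upwards [hfin] with ω hω
  obtain ⟨m, hm⟩ := ENat.ne_top_iff_exists.1 hω
  rw [← hm]
  simp only [tsum_ite_lt_and_eq, ENat.toENNReal_coe]
  split_ifs with h
  · exact le_self_add
  · rw [zero_add]
    exact_mod_cast not_lt.1 h

/-- Convergence of the mean hitting times from that of their tails, under a domination. -/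
theorem tendsto_hittingMoment_one_div [IsProbabilityMeasure μ]
    (hX : ∀ i, 1 ≤ i → Measurable (X i))
    {x : ℕ → ℝ} {C c : ℝ} (hc : 0 < c)     (hbound : ∀ᶠ n : ℕ in atTop, ∀ t : ℝ, 0 < t →
      μ.real (noExceedance X (x n) 1 ⌊t * n⌋₊) ≤ C * (1 + t ^ 2)⁻¹)
    (hlim : ∀ t : ℝ, 0 < t → Tendsto (fun n : ℕ => μ.real (noExceedance X (x n) 1 ⌊t * n⌋₊)) atTop
      (𝓝 (Real.exp (-c * t)))) :
    (∀ᶠ n : ℕ in atTop, ∀ᵐ ω ∂μ, hittingTime X (x n) ω ≠ ⊤) ∧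
    Tendsto (fun n : ℕ => hittingMoment μ X (x n) 1 / (n : ℝ≥0∞)) atTop
      (𝓝 (ENNReal.ofReal (1 / c))) := by
  have hfin : ∀ᶠ n : ℕ in atTop, ∀ᵐ ω ∂μ, hittingTime X (x n) ω ≠ ⊤ := by
    filter_upwards [hbound] with n hn
    have h0 : Tendsto (fun t : ℝ => C * (1 + t ^ 2)⁻¹) atTop (𝓝 0) := by
      have h1 : Tendsto (fun t : ℝ => 1 + t ^ 2) atTop atTop :=
        tendsto_atTop_add_const_left _ _ (tendsto_pow_atTop (by norm_num))
      simpa using h1.inv_tendsto_atTop.const_mul C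
    -- For fixed `n`, the event `T* = ⊤` lies in every tail event, so the bound may be taken as `t →
    -- ∞`.
    have hle : μ.real {ω | hittingTime X (x n) ω = ⊤} ≤ 0 := by
      refine ge_of_tendsto h0 ?_
      filter_upwards [eventually_gt_atTop 0] with t ht
      refine (measureReal_mono fun ω hω => ?_).trans (hn t ht)
      have hω : hittingTime X (x n) ω = ⊤ := hω
      rw [← natCast_lt_hittingTime_iff, hω]
      exact ENat.natCast_lt_top _
    rw [ae_iff]
    simpa using (measureReal_eq_zero_iff).1 (hle.antisymm measureReal_nonneg)
  refine ⟨hfin, ?_⟩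
  have hint : ∫⁻ t in Set.Ioi (0 : ℝ), ENNReal.ofReal (Real.exp (-c * t)) =
      ENNReal.ofReal (1 / c) := by
    rw [← ofReal_integral_eq_lintegral_ofReal (integrableOn_exp_mul_Ioi (by linarith) 0)
      (Eventually.of_forall fun t => (Real.exp_pos _).le), integral_exp_mul_Ioi (by linarith)]
    congr 1
    simp
  rw [← hint]
  have hconv : Tendsto (fun n : ℕ => ∫⁻ t in Set.Ioi (0 : ℝ),
      μ (noExceedance X (x n) 1 ⌊t * n⌋₊)) atTop
      (𝓝 (∫⁻ t in Set.Ioi (0 : ℝ), ENNReal.ofReal (Real.exp (-c * t)))) := by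
    refine tendsto_lintegral_filter_of_dominated_convergence
      (fun t => ENNReal.ofReal (C * (1 + t ^ 2)⁻¹)) (Eventually.of_forall fun n => ?_) ?_ ?_ ?_
    · exact (measurable_from_top (f := fun m : ℕ => μ (noExceedance X (x n) 1 m))).comp
        (Nat.measurable_floor.comp (measurable_id.mul_const _))
    · filter_upwards [hbound] with n hn
      filter_upwards [ae_restrict_mem measurableSet_Ioi] with t ht
      rw [← ofReal_measureReal]
      exact ENNReal.ofReal_le_ofReal (hn t ht)
    · exact ((integrable_inv_one_add_sq.const_mul C).restrict.lintegral_lt_top).ne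
    · filter_upwards [ae_restrict_mem measurableSet_Ioi] with t ht
      refine (ENNReal.tendsto_ofReal (hlim t ht)).congr fun n => ofReal_measureReal
  refine hconv.congr' ?_
  filter_upwards [hfin, eventually_ge_atTop 1] with n h1 hn
  exact (hittingMoment_one_div_eq_lintegral hX (x n) h1 hn).symm

end Moments

end FirstHitting

/-! ### The truncated mean and its normalization -/

theorem lemma1 {Ω : Type*} [MeasurableSpace Ω] (μ : Measure Ω) [IsProbabilityMeasure μ]
    (X : ℕ → Ω → ℝ) (hX : ∀ i, 1 ≤ i → Measurable (X i))
    (hstat : FirstHitting.IsStationary μ X)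
    (θ : ℝ) (hθ : 0 < θ) (hindex : FirstHitting.HasExtremalIndex μ X θ)
    (ρ x : ℕ → ℝ) (hρ : ∀ n, 1 ≤ n → 0 < ρ n ∧ ρ n < 1)
    (hquant : ∀ n, 1 ≤ n → FirstHitting.IsQuantile μ X (1 - ρ n) (x n))
    (τ : ℝ) (hτ : 0 < τ) (hlevel : FirstHitting.IsLevelSequence μ X θ τ x)
    (j₀ : ℕ → ℕ) (hj₀ : (fun n => (j₀ n : ℝ)) =o[atTop] (fun n : ℕ => (n : ℝ)))
    (k : ℕ → ℕ → Fin 6 → ℕ) (q : ℕ → ℕ → Fin 5 → ℕ)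
    (hpart : FirstHitting.IsPartition j₀ k q)
    (hmix : FirstHitting.MixingCondition μ X x ρ j₀ k q)
    (β : ℝ) (hβ : 0 < β)
    (hmoment : (⨆ n : ℕ, ⨆ _ : 1 ≤ n, FirstHitting.hittingMoment μ X (x n) (1 + β) /
      ENNReal.ofReal (FirstHitting.Lam θ (ρ n) (j₀ n))) < ∞) :
    (∀ ε : ℝ, 0 < ε → ∃ N : ℕ, ∀ n : ℕ, N < n →
      FirstHitting.truncatedMean μ X (x n) (j₀ n) ≠ ∞ ∧
        |(FirstHitting.truncatedMean μ X (x n) (j₀ n)).toReal /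
          (FirstHitting.Lam θ (ρ n) (j₀ n) * ρ n) - 1| < ε) ∧
    Tendsto (fun n : ℕ => FirstHitting.Lam θ (ρ n) (j₀ n) * ρ n / (n : ℝ)) atTop
      (𝓝 (1 / (θ * τ))) ∧
    Tendsto (fun n : ℕ => FirstHitting.hittingMoment μ X (x n) 1 / (n : ℝ≥0∞)) atTop
      (𝓝 (ENNReal.ofReal (1 / (θ * τ)))) := by
  have hx := hlevel.1
  obtain ⟨C, hC⟩ := FirstHitting.exists_measureReal_noExceedance_floor_le hX hstat hθ hindex hτ hx hj₀ hpart hmix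
  obtain ⟨hfin, hT⟩ := FirstHitting.tendsto_hittingMoment_one_div hX (mul_pos hτ hθ) hC
    fun t ht => hindex.tendsto_floor hτ hx ht
  rw [mul_comm τ θ] at hT
  have hΛ := FirstHitting.tendsto_Lam_mul_div hθ hτ (fun n hn => (hρ n hn).1)
    (hindex.tendsto_quantile hτ hx hquant) hj₀
  have hpos : 0 < 1 / (θ * τ) := by positivity
  have hj : Tendsto (fun n => (j₀ n : ℝ≥0∞) / n) atTop (𝓝 0) := by
    have := ENNReal.tendsto_ofReal hj₀.tendsto_div_nhds_zero
    rw [ENNReal.ofReal_zero] at this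
    refine this.congr' ?_
    filter_upwards [eventually_ge_atTop 1] with n hn
    rw [ENNReal.ofReal_div_of_pos (by exact_mod_cast hn), ENNReal.ofReal_natCast,
      ENNReal.ofReal_natCast]
  have htrunc : Tendsto (fun n : ℕ => FirstHitting.truncatedMean μ X (x n) (j₀ n) / (n : ℝ≥0∞)) atTop
      (𝓝 (ENNReal.ofReal (1 / (θ * τ)))) := by
    have hsub := ENNReal.Tendsto.sub hT hj (Or.inl ENNReal.ofReal_ne_top)
    rw [tsub_zero] at hsub
    -- Squeeze between `(E T* - j₀) / n` and `E T* / n`.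
    refine tendsto_of_tendsto_of_tendsto_of_le_of_le' hsub hT ?_ ?_
    · filter_upwards [hfin] with n hn
      rw [tsub_le_iff_right, ← ENNReal.add_div]
      exact ENNReal.div_le_div_right (FirstHitting.hittingMoment_le_truncatedMean_add hX (x n) hn (j₀ n)) _
    · exact Eventually.of_forall fun n =>
        ENNReal.div_le_div_right (FirstHitting.truncatedMean_le_hittingMoment hX (x n) (j₀ n)) _
  have htop : ∀ᶠ n : ℕ in atTop, FirstHitting.truncatedMean μ X (x n) (j₀ n) ≠ ∞ := by
    filter_upwards [htrunc.eventually (gt_mem_nhds ENNReal.ofReal_lt_top)] with n hn h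
    rw [h, ENNReal.top_div_of_ne_top (ENNReal.natCast_ne_top n)] at hn
    exact lt_irrefl _ hn
  have hratio : Tendsto (fun n => (FirstHitting.truncatedMean μ X (x n) (j₀ n)).toReal /
      (FirstHitting.Lam θ (ρ n) (j₀ n) * ρ n)) atTop (𝓝 1) := by
    have h1 := (ENNReal.tendsto_toReal ENNReal.ofReal_ne_top).comp htrunc
    rw [ENNReal.toReal_ofReal hpos.le] at h1
    have h2 := h1.div hΛ hpos.ne'
    rw [div_self hpos.ne'] at h2
    refine h2.congr' ?_
    filter_upwards [eventually_ge_atTop 1] with n hn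
    have : (n : ℝ) ≠ 0 := by positivity
    simp only [Function.comp, Pi.div_apply, ENNReal.toReal_div, ENNReal.toReal_natCast]
    exact div_div_div_cancel_right₀ this _ _
  refine ⟨fun ε hε => ?_, hΛ, hT⟩
  obtain ⟨N, hN⟩ := eventually_atTop.1 (htop.and (Metric.tendsto_nhds.1 hratio ε hε))
  exact ⟨N, fun n hn => ⟨(hN n hn.le).1, by simpa [Real.dist_eq] using (hN n hn.le).2⟩⟩
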